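/- Let $\mathbb{X}\subset\mathbb{R}^n$ be compact with Lebesgue measure, $L^2=L^2(\mathbb{X})$, and let $k\colon\mathbb{X}\times\mathbb{X}\to\mathbb{R}$ be a measurable, symmetric, positive definite kernel (i.e. $\sum_{i,j}\alpha_i\alpha_j k(x_i,x_j)\ge 0$ for all finite families of points $x_i\in\mathbb{X}$ and reals $\alpha_i$) with $\int_{\mathbb{X}}k(x,x)\,dx<\infty$ (for instance a continuous one), satisfying the Mercer condition $$\int_{\mathbb{X}}\int_{\mathbb{X}}k(x,x')f(x)f(x')\,dx\,dx'>0\qquad\text{for all } f\in L^2,\ f\neq 0 .$$ Let $\mathbb{H}$ be the reproducing kernel Hilbert space of $k$, and for $h\in L^2$ let $\mu(h)=\int_{\mathbb{X}}k(x,\cdot)h(x)\,dx$ be its kernel mean embedding. Let $(\lambda_i,\varphi_i)_{i\ge 0}$ be the eigenpairs of the integral operator $T_kf=\int_{\mathbb{X}}k(\cdot,x)f(x)\,dx$ on $L^2$, with $L^2$-orthonormal eigenfunctions $\varphi_i$ and with the nonzero eigenvalues listed in nonincreasing order and repeated according to multiplicity. Let $h\in L^2$, put $\tilde h_i=\langle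 \varphi_i,h\rangle_{L^2}$, let $i_{\max}\in\mathbb{N}_0$ be such that $\tilde h_i\ne 0$ for some $i\le i_{\max}$, and define $$c(h,i_{\max})=1+\frac{\sum_{i=i_{\max}+1}^{\infty}\tilde h_i^2}{\sum_{i=0}^{i_{\max}}\tilde h_i^2}.$$ Then $h=\sum_{i=0}^\infty\tilde h_i\varphi_i$ in $L^2$, $\mu(h)\in\mathbb{H}$, and $$\|\mu(h)\|_{\mathbb{H}}\ \ge\ \sqrt{\frac{\lambda_{i_{\max}}}{c(h,i_{\max})}}\;\|h\|_{L^2}.$$ -/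

import Mathlib

open MeasureTheory

attribute [local instance] Measure.Subtype.measureSpace

namespace KernelEmbedding

noncomputable section

/-- `H` is the reproducing kernel Hilbert space of the kernel `k`: for every `x` the function
`k(x, ·)` belongs to `H` and represents the evaluation `f ↦ f x`. (`RKHS.kerFun H x 1` is the
representer of the evaluation at `x`; the span of these functions is automatically dense.) -/
def IsRKHSOf {X : Type*} (k : X → X → ℝ) (H : Type*) [NormedAddCommGroup H]
    [InnerProductSpace ℝ H] [CompleteSpace H] [RKHS ℝ H X ℝ] : Prop :=
  ∀ x y : X, RKHS.kerFun H x 1 y = k x y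

variable {X : Type*} [MeasureSpace X]

/-- The integral operator `(T_k f)(y) = ∫ k(y, x) f(x) dx`. -/
def integralOperator (k : X → X → ℝ) (f : X → ℝ) (y : X) : ℝ :=
  ∫ x, k y x * f x

/-- The kernel mean embedding `μ(p) = ∫ k(x, ·) p(x) dx`, as a function on `X`. -/
def meanEmbedding (k : X → X → ℝ) (p : X → ℝ) (y : X) : ℝ :=
  ∫ x, k x y * p x

/-- The Mercer condition: `∫∫ k(x, x') f(x) f(x') dx dx' > 0` for all `f ≠ 0` in `L²`. -/
def MercerCondition (k : X → X → ℝ) : Prop :=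
  ∀ f : Lp ℝ 2 (volume : Measure X), f ≠ 0 → 0 < ∫ x, ∫ x', k x x' * f x * f x'

/-- The equation `T_k f = r f` in `L²`. -/
def EigenEquation (k : X → X → ℝ) (r : ℝ) (f : Lp ℝ 2 (volume : Measure X)) : Prop :=
  integralOperator k f =ᵐ[volume] fun y => r * f y

/-- `(lam i, φ i)`, `i = 0, 1, 2, …`, are the eigenpairs of `T_k`: the `φ i` are orthonormal
eigenfunctions, the eigenvalues are in nonincreasing order, and all nonzero eigenvalues are listed
with their full multiplicity. It is not required that the `φ i` form a basis of `L²`. -/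
structure IsMercerSystem (k : X → X → ℝ) (lam : ℕ → ℝ)
    (φ : ℕ → Lp ℝ 2 (volume : Measure X)) : Prop where
  orthonormal : Orthonormal ℝ φ
  eigen : ∀ i, EigenEquation k (lam i) (φ i)
  antitone : Antitone lam
  exhaustive : ∀ (r : ℝ) (f : Lp ℝ 2 (volume : Measure X)), r ≠ 0 → EigenEquation k r f →
    f ∈ (Submodule.span ℝ {g | ∃ i, lam i = r ∧ g = φ i}).topologicalClosure

/-- The coefficient of `h` at `φ i`. -/
def coeff (φ : ℕ → Lp ℝ 2 (volume : Measure X)) (h : Lp ℝ 2 (volume : Measure X)) (i : ℕ) : ℝ :=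
  inner ℝ (φ i) h

/-- The regularity factor `c(h, m) = 1 + (∑_{i > m} h_i²) / (∑_{i ≤ m} h_i²)`, used only when the
denominator is nonzero. -/
def regularityFactor (φ : ℕ → Lp ℝ 2 (volume : Measure X)) (h : Lp ℝ 2 (volume : Measure X))
    (m : ℕ) : ℝ :=
  1 + (∑' j : ℕ, coeff φ h (m + 1 + j) ^ 2) / (∑ i ∈ Finset.range (m + 1), coeff φ h i ^ 2)

end

end KernelEmbedding

open Filter Topology

/-! Let J be the inclusion of H into L². Its adjoint sends h to μ(h), and J J* = T_k, so ‖μ(h)‖² =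
⟨T_k h, h⟩. Finite trace makes T_k compact, and it is symmetric; the Mercer condition makes it
injective with positive eigenvalues. By the spectral theorem the φ_i are then complete, and ‖μ(h)‖²
= ∑ λ_i h_i². Keeping only i ≤ i_max and using λ_i ≥ λ_{i_max} there leaves λ_{i_max} ∑_{i ≤ i_max}
h_i², which by Parseval is λ_{i_max} ‖h‖² / c. -/

/-- A continuous linear map that is square summable on a Hilbert basis is compact. -/
theorem HilbertBasis.isCompactOperator_of_summable {ι E F : Type*} [NormedAddCommGroup E]
    [InnerProductSpace ℝ E] [NormedAddCommGroup F] [NormedSpace ℝ F] [CompleteSpace F]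
    (b : HilbertBasis ι ℝ E) (T : E →L[ℝ] F) (hT : Summable fun i => ‖T (b i)‖ ^ 2) :
    IsCompactOperator T := by
  classical
  let A : ι → E →L[ℝ] F := fun i => (innerSL ℝ (b i)).smulRight (T (b i))
  -- Cauchy–Schwarz and Bessel: an ℓ² tail bounds the operator norm of a finite sum of rank-one
  -- pieces, so these sums converge to `T` in norm.
  have hbound : ∀ t : Finset ι, ‖∑ i ∈ t, A i‖ ≤ √(∑ i ∈ t, ‖T (b i)‖ ^ 2) := by
    intro t
    refine ContinuousLinearMap.opNorm_le_bound _ (Real.sqrt_nonneg _) fun x => ?_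
    calc ‖(∑ i ∈ t, A i) x‖ ≤ ∑ i ∈ t, ‖T (b i)‖ * ‖inner ℝ (b i) x‖ := by
          rw [sum_apply]
          refine norm_sum_le_of_le _ fun i _ => ?_
          simp [A, norm_smul, mul_comm]
      _ ≤ √(∑ i ∈ t, ‖T (b i)‖ ^ 2) * √(∑ i ∈ t, ‖inner ℝ (b i) x‖ ^ 2) :=
          Real.sum_mul_le_sqrt_mul_sqrt _ _ _
      _ ≤ √(∑ i ∈ t, ‖T (b i)‖ ^ 2) * ‖x‖ := by
          gcongr
          exact Real.sqrt_le_iff.2 ⟨norm_nonneg _, b.orthonormal.sum_inner_products_le x⟩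
  have hA : Summable A := by
    rw [summable_iff_vanishing_norm]
    intro ε hε
    obtain ⟨s, hs⟩ := summable_iff_vanishing_norm.1 hT (ε ^ 2) (by positivity)
    refine ⟨s, fun t ht => (hbound t).trans_lt ?_⟩
    rw [Real.sqrt_lt' hε]
    exact (Real.le_norm_self _).trans_lt (hs t ht)
  have hlim : ∑' i, A i = T := by
    ext x
    have h1 : HasSum (fun i => A i x) ((∑' i, A i) x) :=
      hA.hasSum.mapL (ContinuousLinearMap.apply ℝ F x)
    have h2 : HasSum (fun i => A i x) (T x) := by
      simpa [A, b.repr_apply_apply] using (b.hasSum_repr x).mapL T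
    exact h1.unique h2
  have hsum : Tendsto (fun t : Finset ι => ∑ i ∈ t, A i) atTop (𝓝 T) := hlim ▸ hA.hasSum
  refine isCompactOperator_of_tendsto hsum (Eventually.of_forall fun t => ?_)
  have hrank : ∀ i, IsCompactOperator (A i) := fun i =>
    ((isCompactOperator_id (E := ℝ)).comp_clm (innerSL ℝ (b i))).clm_comp
      (ContinuousLinearMap.toSpanSingleton ℝ (T (b i)))
  exact (compactOperator (RingHom.id ℝ) E F).sum_mem fun i _ => hrank i

namespace KernelEmbedding

noncomputable section

/-! ### Pointwise bounds and measurability in the RKHS -/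

section RKHS

variable {X : Type*} {k : X → X → ℝ} {H : Type*} [NormedAddCommGroup H] [InnerProductSpace ℝ H]
  [CompleteSpace H] [RKHS ℝ H X ℝ]

theorem inner_kerFun_one (f : H) (x : X) : inner ℝ (RKHS.kerFun H x (1 : ℝ)) f = f x := by
  simp

theorem IsRKHSOf.norm_kerFun_sq (hH : IsRKHSOf k H) (x : X) :
    ‖RKHS.kerFun H x (1 : ℝ)‖ ^ 2 = k x x := by
  rw [← real_inner_self_eq_norm_sq, inner_kerFun_one, hH x x]

theorem IsRKHSOf.diag_nonneg (hH : IsRKHSOf k H) (x : X) : 0 ≤ k x x :=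
  hH.norm_kerFun_sq x ▸ sq_nonneg _

theorem IsRKHSOf.symm (hH : IsRKHSOf k H) (x y : X) : k x y = k y x := by
  rw [← hH x y, ← hH y x, ← inner_kerFun_one, real_inner_comm, inner_kerFun_one]

theorem IsRKHSOf.apply_sq_le (hH : IsRKHSOf k H) (f : H) (x : X) :
    f x ^ 2 ≤ ‖f‖ ^ 2 * k x x := by
  rw [← inner_kerFun_one, ← hH.norm_kerFun_sq, ← mul_pow, mul_comm]
  exact sq_le_sq' (neg_le_of_abs_le (abs_real_inner_le_norm _ _)) (real_inner_le_norm _ _)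

/-- Kernel sections are measurable and span a dense subspace; norm convergence in `H` implies
pointwise convergence. -/
theorem IsRKHSOf.measurable [MeasurableSpace X] (hH : IsRKHSOf k H)
    (hk : Measurable (Function.uncurry k)) (f : H) : Measurable f := by
  have hspan : ∀ g ∈ Submodule.span ℝ {RKHS.kerFun H x v | (x : X) (v : ℝ)}, Measurable g := by
    intro g hg
    induction hg using Submodule.span_induction with
    | mem g hg =>
      obtain ⟨x, v, rfl⟩ := hg
      have : ⇑(RKHS.kerFun H x v) = fun y => v * k x y := by
        ext y
        rw [← hH x y, ← smul_eq_mul, ← Pi.smul_apply, ← RKHS.coe_smul, ← map_smul, smul_eq_mul,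
          mul_one]
      rw [this]
      exact hk.of_uncurry_left.const_mul v
    | zero => rw [RKHS.coe_zero]; exact measurable_zero
    | add g₁ g₂ _ _ h₁ h₂ => rw [RKHS.coe_add]; exact h₁.add h₂
    | smul c g _ hg => rw [RKHS.coe_smul]; exact hg.const_smul c
  have hf : f ∈ closure (Submodule.span ℝ {RKHS.kerFun H x v | (x : X) (v : ℝ)} : Set H) := by
    rw [← Submodule.topologicalClosure_coe, RKHS.kerFun_dense]
    trivial
  obtain ⟨u, hu, hlim⟩ := mem_closure_iff_seq_limit.1 hf
  refine measurable_of_tendsto_metrizable (fun n => hspan _ (hu n)) (tendsto_pi_nhds.2 fun x => ?_)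
  exact ((RKHS.continuous_eval x).tendsto f).comp hlim

end RKHS

/-! ### The inclusion into L², its adjoint and the integral operator -/

section L2

variable {X : Type*} [MeasureSpace X] {k : X → X → ℝ} {H : Type*} [NormedAddCommGroup H]
  [InnerProductSpace ℝ H] [CompleteSpace H] [RKHS ℝ H X ℝ]

theorem IsRKHSOf.memLp (hH : IsRKHSOf k H) (hk : Measurable (Function.uncurry k))
    (hint : Integrable fun x => k x x) (f : H) : MemLp f 2 (volume : Measure X) := by
  have hf := hH.measurable hk f
  rw [memLp_two_iff_integrable_sq hf.aestronglyMeasurable]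
  refine (hint.const_mul (‖f‖ ^ 2)).mono' (hf.pow_const 2).aestronglyMeasurable
    (Eventually.of_forall fun x => ?_)
  rw [Real.norm_of_nonneg (sq_nonneg _)]
  exact hH.apply_sq_le f x

theorem norm_sq_eq_integral (f : Lp ℝ 2 (volume : Measure X)) : ‖f‖ ^ 2 = ∫ x, f x ^ 2 := by
  rw [← real_inner_self_eq_norm_sq, L2.inner_def]
  simp [sq]

/-- The inclusion of the reproducing kernel Hilbert space into `L²`. -/
def IsRKHSOf.inclusion (hH : IsRKHSOf k H) (hk : Measurable (Function.uncurry k))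
    (hint : Integrable fun x => k x x) : H →L[ℝ] Lp ℝ 2 (volume : Measure X) :=
  LinearMap.mkContinuous
    { toFun := fun f => (hH.memLp hk hint f).toLp f
      map_add' := fun f g => by
        rw [← MemLp.toLp_add]
        congr 1
        exact RKHS.coe_add f g
      map_smul' := fun c f => by
        rw [RingHom.id_apply, ← MemLp.toLp_const_smul]
        congr 1
        exact RKHS.coe_smul f c }
    -- The bound f(x)² ≤ ‖f‖² k(x, x), integrated over x.
    (√(∫ x, k x x)) fun f => by
      have hnn : 0 ≤ ∫ x, k x x := integral_nonneg hH.diag_nonneg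
      refine le_of_sq_le_sq ?_ (by positivity)
      rw [mul_pow, Real.sq_sqrt hnn, norm_sq_eq_integral, ← integral_mul_const]
      refine integral_mono_ae (Lp.memLp _).integrable_sq (hint.mul_const _) ?_
      filter_upwards [(hH.memLp hk hint f).coeFn_toLp] with x hx
      change ((hH.memLp hk hint f).toLp f) x ^ 2 ≤ k x x * ‖f‖ ^ 2
      rw [hx, mul_comm]
      exact hH.apply_sq_le f x

variable (hH : IsRKHSOf k H) (hk : Measurable (Function.uncurry k))
  (hint : Integrable fun x => k x x)

theorem IsRKHSOf.coeFn_inclusion (f : H) : hH.inclusion hk hint f =ᵐ[volume] f :=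
  (hH.memLp hk hint f).coeFn_toLp

theorem IsRKHSOf.adjoint_inclusion_eq_inner (h : Lp ℝ 2 (volume : Measure X)) (y : X) :
    (hH.inclusion hk hint).adjoint h y =
      inner ℝ (hH.inclusion hk hint (RKHS.kerFun H y (1 : ℝ))) h := by
  rw [← ContinuousLinearMap.adjoint_inner_right, inner_kerFun_one]

/-- Holds at every point, not just almost everywhere, so μ(h) is an element of `H` without a
vector-valued integral. -/
theorem IsRKHSOf.adjoint_inclusion_apply (h : Lp ℝ 2 (volume : Measure X)) (y : X) :
    (hH.inclusion hk hint).adjoint h y = integralOperator k h y := by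
  rw [hH.adjoint_inclusion_eq_inner, L2.inner_def]
  refine integral_congr_ae ?_
  filter_upwards [hH.coeFn_inclusion hk hint (RKHS.kerFun H y (1 : ℝ))] with x hx
  rw [hx, hH y x]
  simp [mul_comm]

include hH in
theorem IsRKHSOf.integralOperator_eq_meanEmbedding (h : X → ℝ) (y : X) :
    integralOperator k h y = meanEmbedding k h y :=
  integral_congr_ae (Eventually.of_forall fun x => by simp only [hH.symm y x])

/-- The integral operator `T_k` as a bounded operator on `L²`. -/
def IsRKHSOf.integralCLM :
    Lp ℝ 2 (volume : Measure X) →L[ℝ] Lp ℝ 2 (volume : Measure X) :=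
  hH.inclusion hk hint ∘L (hH.inclusion hk hint).adjoint

theorem IsRKHSOf.coeFn_integralCLM (f : Lp ℝ 2 (volume : Measure X)) :
    hH.integralCLM hk hint f =ᵐ[volume] integralOperator k f := by
  filter_upwards [hH.coeFn_inclusion hk hint ((hH.inclusion hk hint).adjoint f)] with y hy
  rw [← hH.adjoint_inclusion_apply hk hint, ← hy]
  rfl

theorem IsRKHSOf.eigenEquation_iff (r : ℝ) (f : Lp ℝ 2 (volume : Measure X)) :
    EigenEquation k r f ↔ hH.integralCLM hk hint f = r • f := by
  have hT := hH.coeFn_integralCLM hk hint f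
  rw [Lp.ext_iff]
  exact ⟨fun h => (hT.trans h).trans (Lp.coeFn_smul r f).symm,
    fun h => (hT.symm.trans h).trans (Lp.coeFn_smul r f)⟩

theorem IsRKHSOf.inner_integralCLM (f g : Lp ℝ 2 (volume : Measure X)) :
    inner ℝ (hH.integralCLM hk hint f) g =
      inner ℝ ((hH.inclusion hk hint).adjoint f) ((hH.inclusion hk hint).adjoint g) := by
  rw [ContinuousLinearMap.adjoint_inner_right]
  rfl

theorem IsRKHSOf.isSymmetric_integralCLM : (hH.integralCLM hk hint).IsSymmetric := fun f g => by
  rw [ContinuousLinearMap.coe_coe, hH.inner_integralCLM, real_inner_comm,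
    ← hH.inner_integralCLM, real_inner_comm]

/-- Hilbert–Schmidt: at each y, Bessel bounds ∑ (T_k b_i)(y)² by ‖J k_y‖² ≤ ‖J‖² k(y, y), which is
integrable. -/
theorem IsRKHSOf.isCompactOperator_integralCLM :
    IsCompactOperator (hH.integralCLM hk hint) := by
  obtain ⟨w, b, -⟩ := exists_hilbertBasis ℝ (Lp ℝ 2 (volume : Measure X))
  refine b.isCompactOperator_of_summable _ ?_
  refine summable_of_sum_le (c := ∫ y, ‖hH.inclusion hk hint‖ ^ 2 * k y y)
    (fun _ => sq_nonneg _) fun s => ?_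
  have hsq : ∀ i, ‖hH.integralCLM hk hint (b i)‖ ^ 2 =
      ∫ y, inner ℝ (b i) (hH.inclusion hk hint (RKHS.kerFun H y (1 : ℝ))) ^ 2 := fun i => by
    rw [norm_sq_eq_integral]
    refine integral_congr_ae ?_
    filter_upwards [hH.coeFn_integralCLM hk hint (b i)] with y hy
    rw [hy, ← hH.adjoint_inclusion_apply hk hint, hH.adjoint_inclusion_eq_inner, real_inner_comm]
  have hmem : ∀ i, Integrable fun y =>
      inner ℝ (b i) (hH.inclusion hk hint (RKHS.kerFun H y (1 : ℝ))) ^ 2 := fun i => by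
    have := (hH.memLp hk hint ((hH.inclusion hk hint).adjoint (b i))).integrable_sq
    simpa only [hH.adjoint_inclusion_eq_inner, real_inner_comm] using this
  simp_rw [hsq]
  rw [← integral_finsetSum _ fun i _ => hmem i]
  refine integral_mono (integrable_finsetSum _ fun i _ => hmem i) (hint.const_mul _) fun y => ?_
  have hbessel := b.orthonormal.sum_inner_products_le (s := s)
    (hH.inclusion hk hint (RKHS.kerFun H y (1 : ℝ)))
  simp only [Real.norm_eq_abs, sq_abs] at hbessel
  refine hbessel.trans ?_
  rw [← hH.norm_kerFun_sq, ← mul_pow]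
  gcongr
  exact ContinuousLinearMap.le_opNorm _ _

theorem IsRKHSOf.norm_adjoint_inclusion_sq (f : Lp ℝ 2 (volume : Measure X)) :
    ‖(hH.inclusion hk hint).adjoint f‖ ^ 2 = ∫ x, ∫ x', k x x' * f x * f x' := by
  rw [← real_inner_self_eq_norm_sq, ← hH.inner_integralCLM, L2.inner_def]
  refine integral_congr_ae ?_
  filter_upwards [hH.coeFn_integralCLM hk hint f] with x hx
  rw [hx, RCLike.inner_apply, conj_trivial, integralOperator, ← integral_const_mul]
  exact integral_congr_ae (Eventually.of_forall fun x' => by ring)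

theorem IsRKHSOf.inner_integralCLM_self_pos (hM : MercerCondition k)
    {f : Lp ℝ 2 (volume : Measure X)} (hf : f ≠ 0) :
    0 < inner ℝ (hH.integralCLM hk hint f) f := by
  rw [hH.inner_integralCLM, real_inner_self_eq_norm_sq, hH.norm_adjoint_inclusion_sq]
  exact hM f hf

/-! ### Completeness of the eigenfunctions and spectral expansions -/

variable {lam : ℕ → ℝ} {φ : ℕ → Lp ℝ 2 (volume : Measure X)}

include hH hk hint in
theorem IsMercerSystem.eigenvalue_pos (hφ : IsMercerSystem k lam φ) (hM : MercerCondition k)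
    (i : ℕ) : 0 < lam i := by
  have hpos := hH.inner_integralCLM_self_pos hk hint hM (hφ.orthonormal.ne_zero i)
  rwa [(hH.eigenEquation_iff hk hint _ _).1 (hφ.eigen i), real_inner_smul_left,
    real_inner_self_eq_norm_sq, hφ.orthonormal.1 i, one_pow, mul_one] at hpos

include hH hk hint in
theorem IsMercerSystem.topologicalClosure_span (hφ : IsMercerSystem k lam φ)
    (hM : MercerCondition k) :
    (Submodule.span ℝ (Set.range φ)).topologicalClosure = ⊤ := by
  have hle : ⨆ r, Module.End.eigenspace
      (hH.integralCLM hk hint : Module.End ℝ (Lp ℝ 2 (volume : Measure X))) r ≤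
      (Submodule.span ℝ (Set.range φ)).topologicalClosure := by
    refine iSup_le fun r f hf => ?_
    rw [Module.End.mem_eigenspace_iff, ContinuousLinearMap.coe_coe] at hf
    -- Exhaustiveness says nothing about r = 0; there the Mercer condition forces the eigenspace to
    -- vanish.
    rcases eq_or_ne r 0 with rfl | hr
    · by_cases hf0 : f = 0
      · exact hf0 ▸ Submodule.zero_mem _
      · have hpos := hH.inner_integralCLM_self_pos hk hint hM hf0
        simp [hf] at hpos
    · refine Submodule.topologicalClosure_mono (Submodule.span_mono ?_)
        (hφ.exhaustive r f hr ((hH.eigenEquation_iff hk hint r f).2 hf))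
      rintro _ ⟨i, -, rfl⟩
      exact Set.mem_range_self i
  rw [Submodule.topologicalClosure_eq_top_iff, ← Submodule.orthogonal_closure, eq_bot_iff,
    ← ContinuousLinearMap.orthogonalComplement_iSup_eigenspaces_eq_bot
      (hH.isCompactOperator_integralCLM hk hint) (hH.isSymmetric_integralCLM hk hint)]
  exact Submodule.orthogonal_le hle

/-- The eigenfunctions of a Mercer system form a Hilbert basis of `L²`. -/
def IsMercerSystem.hilbertBasis (hφ : IsMercerSystem k lam φ) (hM : MercerCondition k) :
    HilbertBasis ℕ ℝ (Lp ℝ 2 (volume : Measure X)) :=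
  HilbertBasis.mk hφ.orthonormal (hφ.topologicalClosure_span hH hk hint hM).ge

theorem IsMercerSystem.hilbertBasis_apply (hφ : IsMercerSystem k lam φ) (hM : MercerCondition k)
    (i : ℕ) : hφ.hilbertBasis hH hk hint hM i = φ i :=
  congrFun (HilbertBasis.coe_mk _ _) i

include hH hk hint in
theorem IsMercerSystem.hasSum_coeff_smul (hφ : IsMercerSystem k lam φ) (hM : MercerCondition k)
    (h : Lp ℝ 2 (volume : Measure X)) : HasSum (fun i => coeff φ h i • φ i) h := by
  simpa only [HilbertBasis.repr_apply_apply, hφ.hilbertBasis_apply, coeff] using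
    (hφ.hilbertBasis hH hk hint hM).hasSum_repr h

include hH hk hint in
theorem IsMercerSystem.hasSum_coeff_sq (hφ : IsMercerSystem k lam φ) (hM : MercerCondition k)
    (h : Lp ℝ 2 (volume : Measure X)) : HasSum (fun i => coeff φ h i ^ 2) (‖h‖ ^ 2) := by
  have := (hφ.hasSum_coeff_smul hH hk hint hM h).mapL (innerSL ℝ h)
  simpa [coeff, real_inner_smul_right, real_inner_comm, sq] using this

theorem IsMercerSystem.hasSum_eigenvalue_mul_coeff_sq (hφ : IsMercerSystem k lam φ)
    (hM : MercerCondition k) (h : Lp ℝ 2 (volume : Measure X)) :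
    HasSum (fun i => lam i * coeff φ h i ^ 2) (‖(hH.inclusion hk hint).adjoint h‖ ^ 2) := by
  rw [← real_inner_self_eq_norm_sq, ← hH.inner_integralCLM, real_inner_comm]
  refine (((hφ.hasSum_coeff_smul hH hk hint hM h).mapL (hH.integralCLM hk hint)).mapL
    (innerSL ℝ h)).congr_fun fun i => ?_
  rw [map_smul, (hH.eigenEquation_iff hk hint _ _).1 (hφ.eigen i), innerSL_apply_apply,
    real_inner_smul_right, real_inner_smul_right, real_inner_comm, coeff]
  ring

include hH hk hint in
theorem IsMercerSystem.regularityFactor_eq (hφ : IsMercerSystem k lam φ) (hM : MercerCondition k)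
    (h : Lp ℝ 2 (volume : Measure X)) {m : ℕ}
    (hm : ∑ i ∈ Finset.range (m + 1), coeff φ h i ^ 2 ≠ 0) :
    regularityFactor φ h m = ‖h‖ ^ 2 / ∑ i ∈ Finset.range (m + 1), coeff φ h i ^ 2 := by
  have hs := hφ.hasSum_coeff_sq hH hk hint hM h
  rw [← hs.tsum_eq, ← hs.summable.sum_add_tsum_nat_add (m + 1), add_div, div_self hm,
    regularityFactor]
  simp only [add_comm]

end L2

end

end KernelEmbedding

theorem mainTheorem5 {n : ℕ} (X : Set (EuclideanSpace ℝ (Fin n))) (hX : IsCompact X)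
    (k : X → X → ℝ) (hk_pos : (Matrix.of k).PosSemidef)
    (hk_meas : Measurable (Function.uncurry k)) (hk_int : Integrable (fun x : X => k x x))
    (hk_mercer : KernelEmbedding.MercerCondition k)
    (H : Type*) [NormedAddCommGroup H] [InnerProductSpace ℝ H] [CompleteSpace H] [RKHS ℝ H X ℝ]
    (hH : KernelEmbedding.IsRKHSOf k H)
    (lam : ℕ → ℝ) (φ : ℕ → Lp ℝ 2 (volume : Measure X))
    (hφ : KernelEmbedding.IsMercerSystem k lam φ)
    (h : Lp ℝ 2 (volume : Measure X)) (i_max : ℕ)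
    (hi : ∃ i ≤ i_max, KernelEmbedding.coeff φ h i ≠ 0) :
    HasSum (fun i => KernelEmbedding.coeff φ h i • φ i) h ∧
    ∃ g : H, (∀ y : X, g y = KernelEmbedding.meanEmbedding k h y) ∧
      Real.sqrt (lam i_max / KernelEmbedding.regularityFactor φ h i_max) * ‖h‖ ≤ ‖g‖ := by
  refine ⟨hφ.hasSum_coeff_smul hH hk_meas hk_int hk_mercer h,
    (hH.inclusion hk_meas hk_int).adjoint h, fun y => ?_, ?_⟩
  · rw [hH.adjoint_inclusion_apply, hH.integralOperator_eq_meanEmbedding]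
  · have hs : 0 < ∑ i ∈ Finset.range (i_max + 1), KernelEmbedding.coeff φ h i ^ 2 := by
      obtain ⟨i, hile, hne⟩ := hi
      exact Finset.sum_pos' (fun _ _ => sq_nonneg _)
        ⟨i, Finset.mem_range.2 (Nat.lt_succ_of_le hile), by positivity⟩
    have hlam := hφ.eigenvalue_pos hH hk_meas hk_int hk_mercer
    have hsum := hφ.hasSum_eigenvalue_mul_coeff_sq hH hk_meas hk_int hk_mercer h
    have hh : 0 < ‖h‖ := by
      obtain ⟨i, -, hne⟩ := hi
      refine norm_pos_iff.2 fun h0 => hne ?_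
      simp [KernelEmbedding.coeff, h0]
    have hl := hlam i_max
    refine le_of_sq_le_sq ?_ (norm_nonneg _)
    rw [hφ.regularityFactor_eq hH hk_meas hk_int hk_mercer h hs.ne', mul_pow,
      Real.sq_sqrt (by positivity)]
    calc lam i_max / (‖h‖ ^ 2 / ∑ i ∈ Finset.range (i_max + 1), KernelEmbedding.coeff φ h i ^ 2)
          * ‖h‖ ^ 2
        = ∑ i ∈ Finset.range (i_max + 1), lam i_max * KernelEmbedding.coeff φ h i ^ 2 := by
          rw [← Finset.mul_sum]
          field_simp
      _ ≤ ∑ i ∈ Finset.range (i_max + 1), lam i * KernelEmbedding.coeff φ h i ^ 2 := by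
          refine Finset.sum_le_sum fun i hi' => ?_
          gcongr
          exact hφ.antitone (Nat.lt_succ_iff.1 (Finset.mem_range.1 hi'))
      -- The dropped terms are nonnegative because every eigenvalue is positive.
      _ ≤ ‖(hH.inclusion hk_meas hk_int).adjoint h‖ ^ 2 :=
          sum_le_hasSum _ (fun i _ => mul_nonneg (hlam i).le (sq_nonneg _)) hsum
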